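/- Let $M\ge 0$, let $I\subset\mathbb{R}$ and $J_m\subset\mathbb{R}^{N_m}$ $(1\le m\le M)$, and put $\mathbf{J}=\prod_m J_m$. Let $H$ be a random variable with values in $I$ and arbitrary law $\mathbf{d}_H$, and let $A_1,\dots,A_M$ be random variables with values in $J_1,\dots,J_M$ that are conditionally independent given $H$. Assume that $A_m$ given $H=h$ has a density $\mathbf{d}_{A_m|H}(\cdot,h)$ with respect to a $\sigma$-finite measure $\nu_m$ on $J_m$ (for instance Lebesgue measure, or counting measure on a discrete set), where $\mathbf{d}_{A_m|H}$ is continuous, bounded and strictly positive on $J_m\times I$. Write $\mathbf{A}=(A_1,\dots,A_M)$ and, for $\mathbf{a}\in\mathbf{J}$ and a function $\varphi$, $$E(\varphi(H)\mid\mathbf{A}=\mathbf{a})=\frac{\int_I\varphi(h)\prod_{m}\mathbf{d}_{A_m|H}(a_m,h)\,\mathbf{d}_H(dh)}{\int_I\prod_{m}\mathbf{d}_{A_m|H}(a_m,h)\,\mathbf{d}_H(dh)} .$$ Suppose that $H$ is sub-Gaussian, i.e. $E(e^{rH^2})<\infty$ for some $r>0$, and that for each $\mathbf{a}\in\mathbf{J}$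 the zeros of the function $z\mapsto E(e^{-2\pi izH}\mid\mathbf{A}=\mathbf{a})$, $z\in\mathbb{C}$, are symmetric under $z\mapsto -z$, counted with multiplicity: whenever $z$ is a zero, $-z$ is a zero of the same multiplicity. Let $K\subset\mathbb{R}$ be an interval (possibly unbounded) with $I\subset K$. Let $W:\mathbb{R}\to\mathbb{R}$ be the restriction of an entire function, even, nonnegative and convex, with $$\alpha_1(|x|^p-1)\le |W(x)|\le\alpha_2(|x|^p+1)\qquad(x\in\mathbb{R})$$ for some constants $\alpha_1,\alpha_2>0$ and $p\ge1$. Then the posterior mean rule $f(\mathbf{a})=E(H\mid\mathbf{A}=\mathbf{a})$ is Bayes optimal among deterministic rules for the cost $W(c-h)$: $f$ is a measurable map $\mathbf{J}\to K$, its risk $E(W(f(\mathbf{A})-H))$ is finite, and $E(W(f(\mathbf{A})-H))\le E(W(g(\mathbf{A})-H))$ for every measurable $g:\mathbf{J}\to K$. -/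

import Mathlib

open MeasureTheory

noncomputable section

/-- The data of a fusion problem with `M` sensors: an object space `I ⊆ ℝ`, feature spaces
`J m ⊆ ℝ ^ (N m)`, the prior law of the object `H` (an arbitrary probability measure on `I`, so that
discrete priors are allowed), and the conditional densities `dens m a h` of the `m`-th sensor output
given `H = h`, which are positive, bounded and jointly continuous.  Densities are taken with respect
to a σ-finite reference measure `ref m` on `J m`: Lebesgue measure for continuous features, counting
measure for discrete ones. -/
structure FusionProblem (M : ℕ) (N : Fin M → ℕ) (I : Set ℝ)
    (J : (m : Fin M) → Set (EuclideanSpace ℝ (Fin (N m)))) where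
  prior : Measure I
  prior_prob : IsProbabilityMeasure prior
  ref : (m : Fin M) → Measure (J m)
  ref_sigmaFinite : ∀ m, SigmaFinite (ref m)
  dens : (m : Fin M) → J m → I → ℝ
  dens_continuous : ∀ m, Continuous fun x : J m × I => dens m x.1 x.2
  dens_bounded : ∀ m, ∃ B : ℝ, ∀ a h, dens m a h ≤ B
  dens_pos : ∀ m a h, 0 < dens m a h
  dens_normalized : ∀ m h, ∫⁻ a, ENNReal.ofReal (dens m a h) ∂(ref m) = 1

namespace FusionProblem

variable {M : ℕ} {N : Fin M → ℕ} {I : Set ℝ}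
  {J : (m : Fin M) → Set (EuclideanSpace ℝ (Fin (N m)))}

/-- The conditional density of `A = (A_1, …, A_M)` given `H = h`; the sensors are conditionally
independent given `H`. -/
def likelihood (P : FusionProblem M N I J) (a : (m : Fin M) → J m) (h : I) : ℝ :=
  ∏ m, P.dens m (a m) h

/-- The joint law of `(H, A)`. -/
def jointLaw (P : FusionProblem M N I J) : Measure (I × ((m : Fin M) → J m)) :=
  (P.prior.prod (Measure.pi P.ref)).withDensity
    fun x => ENNReal.ofReal (P.likelihood x.2 x.1)

/-- The posterior expectation `E(φ(H) | A = a)`, by Bayes' formula. -/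
def postExp {E : Type} [NormedAddCommGroup E] [NormedSpace ℝ E] (P : FusionProblem M N I J)
    (φ : ℝ → E) (a : (m : Fin M) → J m) : E :=
  (∫ h, P.likelihood a h ∂P.prior)⁻¹ • ∫ h : I, P.likelihood a h • φ h ∂P.prior

/-- The posterior mean fusion rule `f(a) = E(H | A = a)`. -/
def posteriorMean (P : FusionProblem M N I J) (a : (m : Fin M) → J m) : ℝ :=
  P.postExp (fun h => h) a

/-- The posterior characteristic function `z ↦ E(exp(-2πizH) | A = a)` of a complex variable. -/
def postChar (P : FusionProblem M N I J) (a : (m : Fin M) → J m) (z : ℂ) : ℂ :=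
  P.postExp (fun h => Complex.exp (-2 * Real.pi * Complex.I * z * (h : ℂ))) a

/-- `H` is sub-Gaussian: `E(exp(r H ^ 2)) < ∞` for some `r > 0`. -/
def SubGaussian (P : FusionProblem M N I J) : Prop :=
  ∃ r : ℝ, 0 < r ∧ Integrable (fun h : I => Real.exp (r * (h : ℝ) ^ 2)) P.prior

/-- For every `a`, the zeros of the posterior characteristic function, counted with multiplicity,
are symmetric under `z ↦ -z`. -/
def SymmetricZeros (P : FusionProblem M N I J) : Prop :=
  ∀ (a : (m : Fin M) → J m) (z : ℂ), P.postChar a z = 0 →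
    P.postChar a (-z) = 0 ∧
      analyticOrderAt (P.postChar a) (-z) = analyticOrderAt (P.postChar a) z

/-- The Bayes risk `E(cost(g(A), H))` of the deterministic rule `g`, as an element of `[0, ∞]`, for
a nonnegative cost. -/
def bayesRisk (P : FusionProblem M N I J) (cost : ℝ → ℝ → ℝ) (g : ((m : Fin M) → J m) → ℝ) :
    ENNReal :=
  ∫⁻ x, ENNReal.ofReal (cost (g x.2) x.1) ∂P.jointLaw

/-- A deterministic fusion rule with decision space `K`: a measurable map from the joint feature
space to `K`. -/
def IsFusionRule (K : Set ℝ) (g : ((m : Fin M) → J m) → ℝ) : Prop :=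
  Measurable g ∧ ∀ a, g a ∈ K

/-- `f` is Bayes optimal: it is a deterministic fusion rule with values in `K`, its risk is finite,
and no deterministic fusion rule with values in `K` has smaller risk. -/
def IsBayesOptimal (P : FusionProblem M N I J) (K : Set ℝ) (cost : ℝ → ℝ → ℝ)
    (f : ((m : Fin M) → J m) → ℝ) : Prop :=
  IsFusionRule K f ∧ P.bayesRisk cost f < ⊤ ∧
    ∀ g : ((m : Fin M) → J m) → ℝ, IsFusionRule K g → P.bayesRisk cost f ≤ P.bayesRisk cost g

end FusionProblem

/-- `W : ℝ → ℝ` is the restriction to the real line of an entire function. -/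
def IsEntireOnReal (W : ℝ → ℝ) : Prop :=
  ∃ F : ℂ → ℂ, Differentiable ℂ F ∧ ∀ x : ℝ, F x = W x

end

/-! Fix `a`. The likelihood is bounded, so the posterior law of `H` is again sub-Gaussian and its
complex moment generating function `F` is entire with `‖F z‖ ≤ C exp (B ‖z‖ ^ 2)`. The zeros being
symmetric, `F z / F (-z)` is entire without zeros, hence equals `exp (g z)`. Jensen's inequality
bounds the circle means of `|Re g|` by `O(R ^ 2)`, so `g` is a polynomial of degree at most two.
Using the relation at both `z` and `-z` kills the quadratic term, which leaves `F z = exp (b z) F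
(-z)` (`EntireGrowth.eq_exp_mul_comp_neg`).

The derivative at `0` gives `b = 2m` with `m` the posterior mean, and on the imaginary axis the
relation says that the posterior is symmetric about `m` (`SymmetricLaw.map_reflection_eq`). For such
a law `m` minimizes any even convex expected cost (`SymmetricLaw.lintegral_cost_le`). Integrating
over `a` compares the risks, and comparison with the constant rule `0` shows finiteness. -/

namespace EntireGrowth

open Complex Metric Filter Topology Real

/-! ### Quotients and logarithms of entire functions. -/

/-- If two entire functions have the same zeros, counted with multiplicity, then their quotient is
an entire function without zeros. -/
theorem exists_quotient {f h : ℂ → ℂ} (hf : Differentiable ℂ f) (hh : Differentiable ℂ h)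
    (hne : ∀ z, analyticOrderAt h z ≠ ⊤)
    (hord : ∀ z, analyticOrderAt f z = analyticOrderAt h z) :
    ∃ q : ℂ → ℂ, Differentiable ℂ q ∧ (∀ z, q z ≠ 0) ∧ ∀ z, f z = q z * h z := by
  have hfa : ∀ z, AnalyticAt ℂ f z := fun z => hf.analyticAt z
  have hha : ∀ z, AnalyticAt ℂ h z := fun z => hh.analyticAt z
  have hm : MeromorphicOn (f / h) Set.univ := fun z _ =>
    (hfa z).meromorphicAt.div (hha z).meromorphicAt
  -- The normal form fills in the removable singularities: order zero everywhere then means analytic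
  -- and nonvanishing everywhere.
  set q := toMeromorphicNFOn (f / h) Set.univ with hq
  have hNF : ∀ z, MeromorphicNFAt q z := fun z =>
    meromorphicNFOn_toMeromorphicNFOn (f / h) Set.univ (Set.mem_univ z)
  have hev : ∀ z, q =ᶠ[𝓝[≠] z] f / h := fun z =>
    hm.toMeromorphicNFOn_eq_self_on_nhdsNE (Set.mem_univ z)
  have hord0 : ∀ z, meromorphicOrderAt q z = 0 := by
    intro z
    rw [meromorphicOrderAt_congr (hev z),
      meromorphicOrderAt_div (hfa z).meromorphicAt (hha z).meromorphicAt,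
      (hfa z).meromorphicOrderAt_eq, (hha z).meromorphicOrderAt_eq, hord z]
    lift analyticOrderAt h z to ℕ using hne z with n
    simp [sub_eq_add_neg]
  have hqa : ∀ z, AnalyticAt ℂ q z := fun z =>
    (hNF z).meromorphicOrderAt_nonneg_iff_analyticAt.1 (hord0 z).ge
  refine ⟨q, fun z => (hqa z).differentiableAt,
    fun z => (hNF z).meromorphicOrderAt_eq_zero_iff.1 (hord0 z), fun z => ?_⟩
  have h1 : ∀ᶠ w in 𝓝[≠] z, h w ≠ 0 := by
    rcases (hha z).eventually_eq_zero_or_eventually_ne_zero with h0 | h0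
    · exact absurd (analyticOrderAt_eq_top.2 h0) (hne z)
    · exact h0
  have h2 : f =ᶠ[𝓝[≠] z] q * h := by
    filter_upwards [hev z, h1] with w hw hw'
    simp [hw, hw']
  have h3 := ((hfa z).frequently_eq_iff_eventually_eq ((hqa z).mul (hha z))).1 h2.frequently
  exact h3.self_of_nhds

/-- An entire function without zeros is the exponential of an entire function. -/
theorem exists_exp_eq {q : ℂ → ℂ} (hq : Differentiable ℂ q) (h0 : ∀ z, q z ≠ 0) :
    ∃ g : ℂ → ℂ, Differentiable ℂ g ∧ ∀ z, q z = Complex.exp (g z) := by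
  have hd : Differentiable ℂ (fun z => deriv q z / q z) :=
    (hq.contDiff (n := 2)).differentiable_deriv_two.div hq h0
  obtain ⟨g, hg0, hg⟩ := hd.isExactOn_univ.with_val_at 0 (Complex.log (q 0))
  have hg' : ∀ z, HasDerivAt g (deriv q z / q z) z := fun z => hg z (Set.mem_univ z)
  refine ⟨g, fun z => (hg' z).differentiableAt, ?_⟩
  have hder : ∀ z, HasDerivAt (fun z => q z * Complex.exp (-g z)) 0 z := by
    intro z
    have := (hq z).hasDerivAt.mul (hg' z).neg.cexp
    convert! this using 1
    field_simp [h0 z]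
    ring
  have hc : ∀ z, q z * Complex.exp (-g z) = 1 := by
    intro z
    rw [is_const_of_deriv_eq_zero (fun z => (hder z).differentiableAt)
      (fun z => (hder z).deriv) z 0, hg0, Complex.exp_neg, Complex.exp_log (h0 0),
      mul_inv_cancel₀ (h0 0)]
  intro z
  have := hc z
  rwa [Complex.exp_neg, mul_inv_eq_one₀ (Complex.exp_ne_zero _)] at this

/-! ### Circle averages, growth and Taylor coefficients. -/

/-- Jensen's inequality: `log ‖f‖` is subharmonic for entire `f`. -/
theorem log_norm_le_circleAverage {f : ℂ → ℂ} (hf : Differentiable ℂ f) (h0 : f 0 ≠ 0)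
    {R : ℝ} (hR : 0 < R) :
    Real.log ‖f 0‖ ≤ circleAverage (fun z => Real.log ‖f z‖) 0 R := by
  have ha : AnalyticOnNhd ℂ f (closedBall 0 |R|) := fun z _ => hf.analyticAt z
  -- Jensen's formula: the excess is the sum over the zeros `u` of multiplicity times `log (R /
  -- ‖u‖)`.
  rw [ha.circleAverage_log_norm hR.ne' h0]
  refine le_add_of_nonneg_left (finsum_nonneg fun u => ?_)
  by_cases hu : u ∈ closedBall (0 : ℂ) |R|
  · refine mul_nonneg ?_ ?_
    · exact_mod_cast (MeromorphicOn.AnalyticOnNhd.divisor_nonneg ha) u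
    · rcases eq_or_ne u 0 with rfl | hu0
      · simp
      · apply Real.log_nonneg
        rw [← div_eq_mul_inv, one_le_div (by simpa using hu0)]
        simpa [abs_of_pos hR] using hu
  · simp [hu]

theorem circleIntegrable_log_norm {f : ℂ → ℂ} (hf : Differentiable ℂ f) (R : ℝ) :
    CircleIntegrable (fun z => Real.log ‖f z‖) 0 R :=
  MeromorphicOn.circleIntegrable_log_norm fun z _ => (hf.analyticAt z).meromorphicAt

/-- The mean of `|log ‖f‖|` over a circle is controlled by an upper bound of `log ‖f‖`. -/
theorem circleAverage_abs_log_norm_le {f : ℂ → ℂ} (hf : Differentiable ℂ f) (h0 : f 0 = 1)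
    {R D : ℝ} (hR : 0 < R) (hD : 0 ≤ D) (hb : ∀ z, ‖z‖ = R → Real.log ‖f z‖ ≤ D) :
    circleAverage (fun z => |Real.log ‖f z‖|) 0 R ≤ 2 * D := by
  have hi := circleIntegrable_log_norm hf R
  have h1 := log_norm_le_circleAverage hf (by simp [h0]) hR
  rw [h0, norm_one, Real.log_one] at h1
  calc circleAverage (fun z => |Real.log ‖f z‖|) 0 R
      ≤ circleAverage (fun z => 2 * D - Real.log ‖f z‖) 0 R := by
        refine circleAverage_mono hi.abs ((circleIntegrable_const _ _ _).sub hi) fun z hz => ?_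
        have := hb z (by simpa [abs_of_pos hR] using hz)
        -- `|x| ≤ 2 * D - x` whenever `x ≤ D` and `0 ≤ D`.
        rcases abs_cases (Real.log ‖f z‖) with h | h <;> linarith
    _ = 2 * D - circleAverage (fun z => Real.log ‖f z‖) 0 R := by
        rw [circleAverage_fun_sub (circleIntegrable_const _ _ _) hi, circleAverage_const]
    _ ≤ 2 * D := by linarith

/-- The Taylor coefficients of an entire function are determined by its real part. -/
theorem taylorCoeff_eq_circleAverage_re {g : ℂ → ℂ} (hg : Differentiable ℂ g) {k : ℕ}
    (hk : k ≠ 0) {R : ℝ} (hR : 0 < R) :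
    (k.factorial : ℂ)⁻¹ * iteratedDeriv k g 0 =
      circleAverage (fun z => 2 * ((g z).re : ℂ) * (z ^ k)⁻¹) 0 R := by
  have hne : ∀ z ∈ sphere (0 : ℂ) |R|, z ≠ 0 := fun z hz =>
    ne_of_mem_sphere hz (abs_pos.2 hR.ne').ne'
  have hcont : ContinuousOn (fun z : ℂ => (z ^ k)⁻¹) (sphere 0 |R|) :=
    (continuousOn_id.pow k).inv₀ fun z hz => pow_ne_zero k (hne z hz)
  have hi1 : CircleIntegrable (fun z => g z * (z ^ k)⁻¹) 0 R :=
    ContinuousOn.circleIntegrable' (hg.continuous.continuousOn.mul hcont)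
  have hi2 : CircleIntegrable (fun z => starRingEnd ℂ (g z) * (z ^ k)⁻¹) 0 R :=
    ContinuousOn.circleIntegrable'
      ((Complex.continuous_conj.comp hg.continuous).continuousOn.mul hcont)
  have h1 : circleAverage (fun z => g z * (z ^ k)⁻¹) 0 R =
      (k.factorial : ℂ)⁻¹ * iteratedDeriv k g 0 := by
    have := (hg.diffContOnCl (s := ball 0 R)).circleIntegral_one_div_sub_center_pow_smul hR k
    rw [circleAverage_eq_circleIntegral hR.ne']
    have h2 : ∀ z : ℂ, (z - 0)⁻¹ • (g z * (z ^ k)⁻¹) = (1 / (z - 0) ^ (k + 1)) • g z := by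
      intro z
      simp only [sub_zero, smul_eq_mul, one_div, pow_succ, mul_inv]
      ring
    simp_rw [h2]
    rw [this, smul_eq_mul, smul_eq_mul]
    have := Complex.two_pi_I_ne_zero
    field_simp
  -- On the circle `z⁻¹ = conj z / R ^ 2`, so the integrand is the conjugate of the entire function
  -- `R ^ (-2k) * g z * z ^ k`, whose mean is its value at `0`.
  have h3 : circleAverage (fun z => starRingEnd ℂ (g z) * (z ^ k)⁻¹) 0 R = 0 := by
    have hd : Differentiable ℂ fun z => ((R : ℂ) ^ (2 * k))⁻¹ * (g z * z ^ k) := by fun_prop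
    have h4 : circleAverage (fun z => ((R : ℂ) ^ (2 * k))⁻¹ * (g z * z ^ k)) 0 R = 0 := by
      rw [(hd.diffContOnCl (s := ball 0 |R|)).circleAverage]
      simp [hk]
    have h5 := (Complex.conjCLE : ℂ →L[ℝ] ℂ).circleAverage_comp_comm (c := 0) (R := R)
      (f := fun z => ((R : ℂ) ^ (2 * k))⁻¹ * (g z * z ^ k))
      (ContinuousOn.circleIntegrable' hd.continuous.continuousOn)
    rw [h4, map_zero] at h5
    refine Eq.trans (circleAverage_congr_sphere fun z hz => ?_) h5
    have hz0 := hne z hz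
    have hzR : z * starRingEnd ℂ z = (R : ℂ) ^ 2 := by
      rw [Complex.mul_conj, Complex.normSq_eq_norm_sq]
      have : ‖z‖ = |R| := by simpa using hz
      rw [this, sq_abs]
      norm_cast
    have hR0 : (R : ℂ) ≠ 0 := by exact_mod_cast hR.ne'
    have hzc : starRingEnd ℂ z ≠ 0 := by simpa using hz0
    simp only [Function.comp, ContinuousLinearEquiv.coe_coe, Complex.conjCLE_apply, map_mul,
      map_inv₀, map_pow, Complex.conj_ofReal]
    rw [pow_mul, ← hzR, mul_pow]
    field_simp
  have h6 := circleAverage_fun_add hi1 hi2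
  rw [h1, h3, add_zero] at h6
  rw [← h6]
  congr 1
  ext z
  rw [← add_mul, Complex.add_conj]
  push_cast
  ring

/-- An `L¹` form of the Borel–Carathéodory estimate; a mean of `|Re g|` is what Jensen's inequality
can control. -/
theorem norm_taylorCoeff_le {g : ℂ → ℂ} (hg : Differentiable ℂ g) {k : ℕ}
    (hk : k ≠ 0) {R : ℝ} (hR : 0 < R) :
    ‖(k.factorial : ℂ)⁻¹ * iteratedDeriv k g 0‖ ≤
      2 * (R ^ k)⁻¹ * circleAverage (fun z => |(g z).re|) 0 R := by
  rw [taylorCoeff_eq_circleAverage_re hg hk hR]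
  rw [circleAverage_def, circleAverage_def, norm_smul, Real.norm_of_nonneg (by positivity),
    smul_eq_mul, mul_left_comm]
  refine mul_le_mul_of_nonneg_left ?_ (by positivity)
  refine (intervalIntegral.norm_integral_le_integral_norm Real.two_pi_pos.le).trans (le_of_eq ?_)
  rw [← intervalIntegral.integral_const_mul]
  congr 1
  ext θ
  simp [abs_of_pos hR]
  ring

/-- An entire function `f` of order at most two, normalized by `f 0 = 1`, whose zeros are symmetric
under `z ↦ -z` satisfies `f z = exp (b z) f (-z)` for some `b`. -/
theorem eq_exp_mul_comp_neg {f : ℂ → ℂ} (hf : Differentiable ℂ f) (h0 : f 0 = 1)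
    {C B : ℝ} (hb : ∀ z, ‖f z‖ ≤ C * Real.exp (B * ‖z‖ ^ 2))
    (hsym : ∀ z, analyticOrderAt f (-z) = analyticOrderAt f z) :
    ∃ b : ℂ, ∀ z, f z = Complex.exp (b * z) * f (-z) := by
  have hfn : Differentiable ℂ fun z => f (-z) := hf.comp differentiable_neg
  have hfa : AnalyticOnNhd ℂ f Set.univ := fun z _ => hf.analyticAt z
  have hfna : AnalyticOnNhd ℂ (fun z => f (-z)) Set.univ := fun z _ => hfn.analyticAt z
  have hcomp : ∀ z, analyticOrderAt (fun z => f (-z)) z = analyticOrderAt f (-z) := fun z =>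
    analyticOrderAt_comp_of_deriv_ne_zero (f := f) (g := fun z : ℂ => -z) (by fun_prop) (by simp)
  have hnt : ∀ z, analyticOrderAt f z ≠ ⊤ := by
    intro z
    rw [Ne, analyticOrderAt_eq_top]
    intro h
    have := hfa.eqOn_zero_of_preconnected_of_eventuallyEq_zero isPreconnected_univ
      (Set.mem_univ z) h (Set.mem_univ 0)
    simp [h0] at this
  obtain ⟨q, hq, hq0, hfq⟩ := exists_quotient hf hfn (fun z => by rw [hcomp]; exact hnt _)
    (fun z => by rw [hcomp, hsym])
  obtain ⟨g, hg, hqg⟩ := exists_exp_eq hq hq0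
  have hC : 1 ≤ C := by simpa [h0] using hb 0
  have hre : ∀ R : ℝ, 0 < R →
      circleAverage (fun z => |(g z).re|) 0 R ≤ 4 * (Real.log C + |B| * R ^ 2) := by
    intro R hR
    have hD : 0 ≤ Real.log C + |B| * R ^ 2 := by
      have := Real.log_nonneg hC
      positivity
    have hlog : ∀ z, ‖z‖ = R → Real.log ‖f z‖ ≤ Real.log C + |B| * R ^ 2 := by
      intro z hz
      rcases eq_or_ne (f z) 0 with h | h
      · simpa [h] using hD
      · calc Real.log ‖f z‖ ≤ Real.log (C * Real.exp (B * ‖z‖ ^ 2)) :=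
              Real.log_le_log (norm_pos_iff.2 h) (hb z)
          _ = Real.log C + B * R ^ 2 := by
              rw [Real.log_mul (by positivity) (Real.exp_ne_zero _), Real.log_exp, hz]
          _ ≤ _ := by gcongr; exact le_abs_self B
    have h1 := circleAverage_abs_log_norm_le hf h0 hR hD hlog
    have h2 := circleAverage_abs_log_norm_le hfn (by simpa using h0) hR hD
      (fun z hz => hlog (-z) (by simpa using hz))
    have hi1 := circleIntegrable_log_norm hf R
    have hi2 := circleIntegrable_log_norm hfn R
    -- `Re g = log ‖f z‖ - log ‖f (-z)‖` may fail at zeros, where `Real.log 0 = 0`; these are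
    -- discrete and do not affect the average.
    have hz1 := codiscreteWithin_mono (Set.subset_univ (sphere (0 : ℂ) |R|))
      (hfa.preimage_zero_mem_codiscrete (x := 0) (by simp [h0]))
    have hz2 := codiscreteWithin_mono (Set.subset_univ (sphere (0 : ℂ) |R|))
      (hfna.preimage_zero_mem_codiscrete (x := 0) (by simp [h0]))
    calc circleAverage (fun z => |(g z).re|) 0 R
        = circleAverage (fun z => |Real.log ‖f z‖ - Real.log ‖f (-z)‖|) 0 R := by
          refine circleAverage_congr_codiscreteWithin ?_ hR.ne'
          filter_upwards [hz1, hz2] with z hz1 hz2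
          have hz2' : f (-z) ≠ 0 := hz2
          rw [hfq z, norm_mul, Real.log_mul (by simpa using hq0 z) (by simpa using hz2'), hqg,
            Complex.norm_exp, Real.log_exp, add_sub_cancel_right]
      _ ≤ circleAverage (fun z => |Real.log ‖f z‖| + |Real.log ‖f (-z)‖|) 0 R :=
          circleAverage_mono (hi1.sub hi2).abs (hi1.abs.add hi2.abs) fun z _ => abs_sub _ _
      _ = circleAverage (fun z => |Real.log ‖f z‖|) 0 R
          + circleAverage (fun z => |Real.log ‖f (-z)‖|) 0 R :=
          circleAverage_fun_add hi1.abs hi2.abs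
      _ ≤ _ := by linarith
  -- The coefficient is `O(R ^ (2 - k))`; let `R` tend to infinity.
  have hcoeff : ∀ k : ℕ, 3 ≤ k → (k.factorial : ℂ)⁻¹ * iteratedDeriv k g 0 = 0 := by
    intro k hk
    have hlim : Tendsto (fun R : ℝ => 8 * (Real.log C + |B|) * R⁻¹) atTop (𝓝 0) := by
      simpa using tendsto_inv_atTop_zero.const_mul (8 * (Real.log C + |B|))
    rw [← norm_le_zero_iff]
    refine ge_of_tendsto hlim ?_
    filter_upwards [eventually_ge_atTop 1] with R hR
    have hR0 : 0 < R := by linarith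
    refine (norm_taylorCoeff_le hg (by omega) hR0).trans ?_
    have hlC := Real.log_nonneg hC
    have hpow : (R ^ k)⁻¹ ≤ (R ^ 3)⁻¹ := inv_anti₀ (by positivity) (pow_le_pow_right₀ hR hk)
    calc 2 * (R ^ k)⁻¹ * circleAverage (fun z => |(g z).re|) 0 R
        ≤ 2 * (R ^ 3)⁻¹ * (4 * (Real.log C + |B| * R ^ 2)) := by
          gcongr
          · exact circleAverage_nonneg_of_nonneg fun z _ => abs_nonneg _
          · exact hre R hR0
      _ ≤ 2 * (R ^ 3)⁻¹ * (4 * (Real.log C * R ^ 2 + |B| * R ^ 2)) := by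
          gcongr
          exact le_mul_of_one_le_right hlC (one_le_pow₀ hR)
      _ = 8 * (Real.log C + |B|) * R⁻¹ := by
          field_simp
          ring
  obtain ⟨a₁, a₂, hga⟩ : ∃ a₁ a₂ : ℂ, ∀ z, g z = g 0 + a₁ * z + a₂ * z ^ 2 := by
    refine ⟨iteratedDeriv 1 g 0, (2 : ℂ)⁻¹ * iteratedDeriv 2 g 0, fun z => ?_⟩
    rw [← Complex.taylorSeries_eq_of_entire' 0 z hg, tsum_eq_sum (s := Finset.range 3)]
    · simp [Finset.sum_range_succ]
    · intro k hk
      rw [hcoeff k (by simpa using hk), zero_mul]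
  have hg0 : Complex.exp (g 0) = 1 := by
    have := hfq 0
    rw [hqg] at this
    simpa [h0] using this.symm
  -- The relation at `z` and at `-z` gives `exp (2 * a₂ * z ^ 2) = 1` where `f z ≠ 0`. For small `z
  -- ≠ 0` the exponent has norm below `2π`, so it vanishes.
  have ha₂ : a₂ = 0 := by
    have hcont : ∀ᶠ z in 𝓝 (0 : ℂ), f z ≠ 0 ∧ ‖2 * a₂ * z ^ 2‖ < 2 * π := by
      refine (hf.continuous.continuousAt.eventually_ne (by simp [h0])).and ?_
      have : Continuous fun z : ℂ => ‖2 * a₂ * z ^ 2‖ := by fun_prop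
      exact this.continuousAt.eventually_lt continuousAt_const (by simpa using Real.pi_pos)
    obtain ⟨z, ⟨hz1, hz2⟩, hz3⟩ :=
      ((hcont.filter_mono nhdsWithin_le_nhds).and (self_mem_nhdsWithin (s := {(0 : ℂ)}ᶜ))).exists
    have h1 := hfq z
    have h2 := hfq (-z)
    rw [neg_neg] at h2
    rw [h2, ← mul_assoc, eq_comm, mul_eq_right₀ hz1, hqg, hqg, ← Complex.exp_add, hga z, hga (-z)]
      at h1
    have h3 : Complex.exp (2 * a₂ * z ^ 2) = 1 := by
      rw [← h1, show g 0 + a₁ * z + a₂ * z ^ 2 + (g 0 + a₁ * -z + a₂ * (-z) ^ 2) =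
        g 0 + g 0 + 2 * a₂ * z ^ 2 by ring, Complex.exp_add, Complex.exp_add, hg0]
      simp
    obtain ⟨n, hn⟩ := Complex.exp_eq_one_iff.1 h3
    have hn0 : n = 0 := by
      rw [hn] at hz2
      have h4 : ‖(n : ℂ) * (2 * π * Complex.I)‖ = |(n : ℝ)| * (2 * π) := by
        simp [abs_of_pos Real.pi_pos]
      rw [h4] at hz2
      have h5 : |(n : ℝ)| < 1 := by
        by_contra! h
        nlinarith [Real.pi_pos]
      exact Int.abs_lt_one_iff.1 (by exact_mod_cast h5)
    rw [hn0] at hn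
    have hz0 : z ≠ 0 := hz3
    simpa [hz0] using hn
  refine ⟨a₁, fun z => ?_⟩
  rw [hfq z, hqg, hga z, ha₂, zero_mul, add_zero, Complex.exp_add, hg0, one_mul]

end EntireGrowth

/-! ### Sub-Gaussian and symmetric laws on the line. -/

namespace SymmetricLaw

open Complex ProbabilityTheory

theorem exp_mul_le_exp_sq {r : ℝ} (hr : 0 < r) (t x : ℝ) :
    Real.exp (t * x) ≤ Real.exp (t ^ 2 / (4 * r)) * Real.exp (r * x ^ 2) := by
  rw [← Real.exp_add, Real.exp_le_exp]
  have h : t ^ 2 / (4 * r) + r * x ^ 2 - t * x = (t - 2 * r * x) ^ 2 / (4 * r) := by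
    field_simp
    ring
  have : 0 ≤ (t - 2 * r * x) ^ 2 / (4 * r) := by positivity
  linarith

variable {μ : Measure ℝ} {r : ℝ}

theorem integrable_exp_mul (hr : 0 < r) (hint : Integrable (fun x => Real.exp (r * x ^ 2)) μ)
    (t : ℝ) : Integrable (fun x => Real.exp (t * x)) μ := by
  refine (hint.const_mul (Real.exp (t ^ 2 / (4 * r)))).mono' (by fun_prop) ?_
  refine Filter.Eventually.of_forall fun x => ?_
  rw [Real.norm_of_nonneg (Real.exp_nonneg _)]
  exact exp_mul_le_exp_sq hr t x

theorem integrableExpSet_id_eq_univ (hr : 0 < r)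
    (hint : Integrable (fun x => Real.exp (r * x ^ 2)) μ) :
    integrableExpSet id μ = Set.univ :=
  Set.eq_univ_of_forall fun t => integrable_exp_mul hr hint t

theorem hasDerivAt_complexMGF (hr : 0 < r)
    (hint : Integrable (fun x => Real.exp (r * x ^ 2)) μ) (z : ℂ) :
    HasDerivAt (complexMGF id μ) (∫ x, (x : ℂ) * cexp (z * x) ∂μ) z :=
  ProbabilityTheory.hasDerivAt_complexMGF (X := id) (by
    rw [integrableExpSet_id_eq_univ hr hint, interior_univ]
    trivial)

/-- Completing the square in the exponent yields the order-two growth required by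
`EntireGrowth.eq_exp_mul_comp_neg`. -/
theorem norm_complexMGF_le (hr : 0 < r)
    (hint : Integrable (fun x => Real.exp (r * x ^ 2)) μ) (z : ℂ) :
    ‖complexMGF id μ z‖ ≤ (∫ x, Real.exp (r * x ^ 2) ∂μ) * Real.exp ((4 * r)⁻¹ * ‖z‖ ^ 2) := by
  refine norm_complexMGF_le_mgf.trans ?_
  calc ∫ x, Real.exp (z.re * x) ∂μ
      ≤ ∫ x, Real.exp ((4 * r)⁻¹ * ‖z‖ ^ 2) * Real.exp (r * x ^ 2) ∂μ := by
        refine integral_mono (integrable_exp_mul hr hint _) (hint.const_mul _) fun x => ?_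
        refine (exp_mul_le_exp_sq hr z.re x).trans ?_
        have : z.re ^ 2 ≤ ‖z‖ ^ 2 := by
          rw [← sq_abs]
          gcongr
          exact abs_re_le_norm z
        rw [div_eq_inv_mul]
        gcongr
    _ = _ := by rw [integral_const_mul, mul_comm]

/-- A sub-Gaussian law on the line whose complex moment generating function has zeros symmetric
under `z ↦ -z` is symmetric about its mean. -/
theorem map_reflection_eq [IsProbabilityMeasure μ] (hr : 0 < r)
    (hint : Integrable (fun x => Real.exp (r * x ^ 2)) μ)
    (hsym : ∀ z, analyticOrderAt (complexMGF id μ) (-z) = analyticOrderAt (complexMGF id μ) z) :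
    μ.map (fun x => 2 * (∫ y, y ∂μ) - x) = μ := by
  set m := ∫ y, y ∂μ with hm
  have hd := hasDerivAt_complexMGF hr hint
  have h0 : complexMGF id μ 0 = 1 := by simp [complexMGF]
  obtain ⟨b, hb⟩ := EntireGrowth.eq_exp_mul_comp_neg (fun z => (hd z).differentiableAt) h0
    (norm_complexMGF_le hr hint) hsym
  have hd0 : HasDerivAt (complexMGF id μ) (m : ℂ) 0 := by
    have h := hd 0
    simp only [zero_mul, Complex.exp_zero, mul_one] at h
    rwa [integral_complex_ofReal, ← hm] at h
  -- Differentiating `F z = exp (b z) F (-z)` at `0` gives `m = b - m`.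
  have hbm : b = 2 * m := by
    have hd0' : HasDerivAt (complexMGF id μ) (m : ℂ) (-0) := by simpa using hd0
    have h1 : HasDerivAt (fun z => cexp (b * z) * complexMGF id μ (-z))
        (cexp (b * 0) * (b * 1) * complexMGF id μ (-0) +
          cexp (b * 0) * ((m : ℂ) * -1)) 0 :=
      ((hasDerivAt_id (0 : ℂ)).const_mul b).cexp.mul (hd0'.comp 0 (hasDerivAt_neg 0))
    have h2 := hd0.unique (h1.congr_of_eventuallyEq (Filter.Eventually.of_forall hb))
    simp [h0] at h2
    linear_combination -h2
  clear_value m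
  have hmeas : Measurable fun x : ℝ => 2 * m - x := by fun_prop
  have : IsProbabilityMeasure (μ.map fun x => 2 * m - x) :=
    Measure.isProbabilityMeasure_map hmeas.aemeasurable
  -- At `z = t * I` the factor `exp (2 m z)` times `F (-z)` is the characteristic function of the
  -- reflected law.
  refine Measure.ext_of_charFun (funext fun t => ?_)
  rw [← complexMGF_id_mul_I (μ := μ), hb, hbm, ← complexMGF_id_mul_I, complexMGF, complexMGF,
    integral_map hmeas.aemeasurable (by fun_prop), ← integral_const_mul]
  refine integral_congr_ae (Filter.Eventually.of_forall fun x => ?_)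
  simp only
  rw [← Complex.exp_add]
  simp only [id]
  push_cast
  ring_nf

/-- If a law is symmetric about `m`, then `m` minimizes the expected even convex cost. -/
theorem lintegral_cost_le {m : ℝ} (hμ : μ.map (fun x => 2 * m - x) = μ) {W : ℝ → ℝ}
    (heven : ∀ x, W (-x) = W x) (hnonneg : ∀ x, 0 ≤ W x) (hconvex : ConvexOn ℝ Set.univ W)
    (c : ℝ) :
    ∫⁻ x, ENNReal.ofReal (W (m - x)) ∂μ ≤ ∫⁻ x, ENNReal.ofReal (W (c - x)) ∂μ := by
  have hW : Continuous W := by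
    simpa [continuousOn_univ] using hconvex.continuousOn isOpen_univ
  have hmW : ∀ c, Measurable fun x => ENNReal.ofReal (W (c - x)) := fun c => by
    have : Continuous fun x => W (c - x) := by fun_prop
    exact this.measurable.ennreal_ofReal
  have hrefl : ∫⁻ x, ENNReal.ofReal (W (2 * m - c - x)) ∂μ =
      ∫⁻ x, ENNReal.ofReal (W (c - x)) ∂μ := by
    conv_rhs => rw [← hμ, lintegral_map (hmW c) (by fun_prop)]
    congr 1
    ext x
    rw [← heven]
    ring_nf
  -- `m - x` is the midpoint of `c - x` and `2 * m - c - x`, whose costs have equal integrals by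
  -- `hrefl`.
  have hpt : ∀ x, 2 * ENNReal.ofReal (W (m - x)) ≤
      ENNReal.ofReal (W (c - x)) + ENNReal.ofReal (W (2 * m - c - x)) := by
    intro x
    have h := hconvex.2 (Set.mem_univ (c - x)) (Set.mem_univ (2 * m - c - x))
      (show (0 : ℝ) ≤ 1 / 2 by norm_num) (show (0 : ℝ) ≤ 1 / 2 by norm_num) (by norm_num)
    simp only [smul_eq_mul] at h
    rw [show 1 / 2 * (c - x) + 1 / 2 * (2 * m - c - x) = m - x by ring] at h
    rw [← ENNReal.ofReal_add (hnonneg _) (hnonneg _), ← ENNReal.ofReal_ofNat,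
      ← ENNReal.ofReal_mul (by norm_num)]
    exact ENNReal.ofReal_le_ofReal (by linarith)
  have h := lintegral_mono (μ := μ) hpt
  rw [lintegral_const_mul _ (hmW m), lintegral_add_left (hmW c), hrefl, ← two_mul] at h
  exact (ENNReal.mul_le_mul_iff_right (by norm_num) (by norm_num)).1 h

end SymmetricLaw

/-! ### The posterior laws. -/

namespace FusionProblem

variable {M : ℕ} {N : Fin M → ℕ} {I : Set ℝ}
  {J : (m : Fin M) → Set (EuclideanSpace ℝ (Fin (N m)))} (P : FusionProblem M N I J)

theorem continuous_likelihood :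
    Continuous fun x : ((m : Fin M) → J m) × I => P.likelihood x.1 x.2 := by
  unfold likelihood
  refine continuous_finsetProd _ fun m _ => ?_
  exact (P.dens_continuous m).comp
    (f := fun x : ((m : Fin M) → J m) × I => (x.1 m, x.2)) (by fun_prop)

theorem continuous_likelihood_right (a : (m : Fin M) → J m) : Continuous (P.likelihood a) :=
  P.continuous_likelihood.comp (f := fun h : I => (a, h)) (by fun_prop)

theorem likelihood_pos (a : (m : Fin M) → J m) (h : I) : 0 < P.likelihood a h :=
  Finset.prod_pos fun m _ => P.dens_pos m (a m) h

theorem exists_likelihood_le : ∃ B : ℝ, ∀ a h, P.likelihood a h ≤ B := by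
  choose B hB using P.dens_bounded
  exact ⟨∏ m, B m, fun a h =>
    Finset.prod_le_prod (fun m _ => (P.dens_pos m (a m) h).le) fun m _ => hB m (a m) h⟩

theorem integrable_likelihood_smul {E : Type} [NormedAddCommGroup E] [NormedSpace ℝ E]
    (a : (m : Fin M) → J m) {φ : I → E} (hφ : Integrable φ P.prior) :
    Integrable (fun h => P.likelihood a h • φ h) P.prior := by
  obtain ⟨B, hB⟩ := P.exists_likelihood_le
  refine hφ.bdd_smul B (P.continuous_likelihood_right a).aestronglyMeasurable
    (Filter.Eventually.of_forall fun h => ?_)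
  rw [Real.norm_of_nonneg (P.likelihood_pos a h).le]
  exact hB a h

/-- The marginal density of `A` at `a`. -/
noncomputable def evidence (a : (m : Fin M) → J m) : ℝ := ∫ h, P.likelihood a h ∂P.prior

theorem integrable_likelihood (a : (m : Fin M) → J m) : Integrable (P.likelihood a) P.prior := by
  have := P.prior_prob
  simpa using P.integrable_likelihood_smul a (integrable_const (1 : ℝ))

theorem evidence_pos (a : (m : Fin M) → J m) : 0 < P.evidence a := by
  have := P.prior_prob
  rw [evidence, integral_pos_iff_support_of_nonneg (fun h => (P.likelihood_pos a h).le)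
    (P.integrable_likelihood a)]
  have : Function.support (P.likelihood a) = Set.univ :=
    Set.eq_univ_of_forall fun h => (P.likelihood_pos a h).ne'
  simp [this]

/-- The conditional law of `H` given `A = a`, on the object space. -/
noncomputable def posterior (a : (m : Fin M) → J m) : Measure I :=
  (ENNReal.ofReal (P.evidence a))⁻¹ •
    P.prior.withDensity fun h => ENNReal.ofReal (P.likelihood a h)

theorem measurable_ofReal_likelihood (a : (m : Fin M) → J m) :
    Measurable fun h => ENNReal.ofReal (P.likelihood a h) :=
  (P.continuous_likelihood_right a).measurable.ennreal_ofReal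

/-- With the evidence kept as a factor, integration over `a` turns this into the disintegration of
the joint law. -/
theorem lintegral_posterior (a : (m : Fin M) → J m) {F : I → ENNReal} (hF : Measurable F) :
    ENNReal.ofReal (P.evidence a) * ∫⁻ h, F h ∂P.posterior a =
      ∫⁻ h, ENNReal.ofReal (P.likelihood a h) * F h ∂P.prior := by
  rw [posterior, lintegral_smul_measure,
    lintegral_withDensity_eq_lintegral_mul _ (P.measurable_ofReal_likelihood a) hF, smul_eq_mul,
    ← mul_assoc, ENNReal.mul_inv_cancel (by simpa using P.evidence_pos a) ENNReal.ofReal_ne_top,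
    one_mul]
  rfl

instance isProbabilityMeasure_posterior (a : (m : Fin M) → J m) :
    IsProbabilityMeasure (P.posterior a) := by
  constructor
  have h := P.lintegral_posterior a (F := fun _ => 1) measurable_const
  simp only [mul_one, lintegral_const, one_mul] at h
  rw [← ofReal_integral_eq_lintegral_ofReal (P.integrable_likelihood a)
    (Filter.Eventually.of_forall fun h => (P.likelihood_pos a h).le)] at h
  have h0 : ENNReal.ofReal (P.evidence a) ≠ 0 := by simpa using P.evidence_pos a
  exact (ENNReal.mul_right_inj h0 ENNReal.ofReal_ne_top).1 (by rw [h, mul_one]; rfl)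

theorem postExp_eq_integral {E : Type} [NormedAddCommGroup E] [NormedSpace ℝ E]
    (φ : ℝ → E) (a : (m : Fin M) → J m) :
    P.postExp φ a = ∫ h : I, φ h ∂P.posterior a := by
  rw [posterior, integral_smul_measure,
    integral_withDensity_eq_integral_toReal_smul (P.measurable_ofReal_likelihood a) (by simp),
    ENNReal.toReal_inv, ENNReal.toReal_ofReal (P.evidence_pos a).le]
  simp_rw [ENNReal.toReal_ofReal (P.likelihood_pos a _).le]
  rfl

/-- Boundedness of the likelihood transfers sub-Gaussianity from the prior to every posterior, with
the same `r`. -/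
theorem integrable_posterior {E : Type} [NormedAddCommGroup E] [NormedSpace ℝ E]
    (a : (m : Fin M) → J m) {φ : I → E} (hφ : Integrable φ P.prior) :
    Integrable φ (P.posterior a) := by
  refine Integrable.smul_measure ?_ (by simpa using P.evidence_pos a)
  rw [integrable_withDensity_iff_integrable_smul' (P.measurable_ofReal_likelihood a) (by simp)]
  simp_rw [ENNReal.toReal_ofReal (P.likelihood_pos a _).le]
  exact P.integrable_likelihood_smul a hφ

/-- The conditional law of `H` given `A = a`, on the real line. -/
noncomputable def postLaw (a : (m : Fin M) → J m) : Measure ℝ := (P.posterior a).map Subtype.val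

instance isProbabilityMeasure_postLaw (a : (m : Fin M) → J m) :
    IsProbabilityMeasure (P.postLaw a) :=
  Measure.isProbabilityMeasure_map measurable_subtype_coe.aemeasurable

theorem integrable_postLaw {φ : ℝ → ℝ} (hφ : Continuous φ)
    (hi : Integrable (fun h : I => φ h) P.prior) (a : (m : Fin M) → J m) :
    Integrable φ (P.postLaw a) :=
  (integrable_map_measure hφ.aestronglyMeasurable measurable_subtype_coe.aemeasurable).2
    (P.integrable_posterior a hi)

theorem postExp_eq_integral_postLaw {E : Type} [NormedAddCommGroup E] [NormedSpace ℝ E]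
    [SecondCountableTopology E] {φ : ℝ → E} (hφ : Continuous φ) (a : (m : Fin M) → J m) :
    P.postExp φ a = ∫ x, φ x ∂P.postLaw a := by
  rw [postExp_eq_integral, postLaw,
    integral_map measurable_subtype_coe.aemeasurable hφ.aestronglyMeasurable]

theorem postChar_eq_complexMGF (a : (m : Fin M) → J m) (z : ℂ) :
    P.postChar a z =
      ProbabilityTheory.complexMGF id (P.postLaw a) (-2 * Real.pi * Complex.I * z) := by
  rw [postChar, postExp_eq_integral_postLaw P (by fun_prop)]
  rfl

/-! ### Symmetry, moments and range of the posterior mean. -/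

variable {P}

/-- Off the zeros both orders are `0`, because a zero at `-z` would force one at `z`. -/
theorem SymmetricZeros.analyticOrderAt_postChar_neg (hz : P.SymmetricZeros)
    (hd : ∀ a, Differentiable ℂ (P.postChar a)) (a : (m : Fin M) → J m) (z : ℂ) :
    analyticOrderAt (P.postChar a) (-z) = analyticOrderAt (P.postChar a) z := by
  by_cases h : P.postChar a z = 0
  · exact (hz a z h).2
  · have h' : P.postChar a (-z) ≠ 0 := fun h' => h (by simpa using (hz a (-z) h').1)
    rw [((hd a).analyticAt z).analyticOrderAt_eq_zero.2 h,
      ((hd a).analyticAt (-z)).analyticOrderAt_eq_zero.2 h']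

/-- For a sub-Gaussian prior and symmetric zeros, each posterior law is symmetric about the
posterior mean. -/
theorem SymmetricZeros.map_reflection_postLaw (hz : P.SymmetricZeros) (hs : P.SubGaussian)
    (a : (m : Fin M) → J m) :
    (P.postLaw a).map (fun x => 2 * P.posteriorMean a - x) = P.postLaw a := by
  obtain ⟨r, hr, hint⟩ := hs
  have hint' := fun a => P.integrable_postLaw (φ := fun x => Real.exp (r * x ^ 2))
    (by fun_prop) hint a
  have hdiff : ∀ a, Differentiable ℂ (ProbabilityTheory.complexMGF id (P.postLaw a)) := fun a z =>
    (SymmetricLaw.hasDerivAt_complexMGF hr (hint' a) z).differentiableAt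
  set c : ℂ := -2 * Real.pi * Complex.I with hc
  have hc0 : c ≠ 0 := by simp [hc, Real.pi_ne_zero]
  have hchar : ∀ a, P.postChar a =
      ProbabilityTheory.complexMGF id (P.postLaw a) ∘ fun z => c * z := fun a =>
    funext fun z => P.postChar_eq_complexMGF a z
  have hdc : ∀ a, Differentiable ℂ (P.postChar a) := fun a => by
    rw [hchar]
    exact (hdiff a).comp (by fun_prop)
  -- The rescaling `z ↦ c * z` with `c ≠ 0` preserves orders and commutes with negation.
  have hord : ∀ z, analyticOrderAt (P.postChar a) z =
      analyticOrderAt (ProbabilityTheory.complexMGF id (P.postLaw a)) (c * z) := fun z => by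
    rw [hchar]
    refine analyticOrderAt_comp_of_deriv_ne_zero (by fun_prop) ?_
    rw [deriv_const_mul _ differentiableAt_fun_id]
    simpa using hc0
  have hmean : P.posteriorMean a = ∫ x, x ∂P.postLaw a :=
    P.postExp_eq_integral_postLaw continuous_id a
  rw [hmean]
  refine SymmetricLaw.map_reflection_eq hr (hint' a) fun w => ?_
  have h := hz.analyticOrderAt_postChar_neg hdc a (c⁻¹ * w)
  rwa [hord, hord, mul_neg, mul_inv_cancel_left₀ hc0] at h

theorem SubGaussian.integrable_rpow_abs (hs : P.SubGaussian) {p : ℝ} (hp : 0 ≤ p) :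
    Integrable (fun h : I => |(h : ℝ)| ^ p) P.prior := by
  obtain ⟨r, hr, hint⟩ := hs
  refine ProbabilityTheory.integrable_rpow_abs_of_mem_interior_integrableExpSet
    (X := Subtype.val) ?_ hp
  have hint' : Integrable (fun x => Real.exp (r * x ^ 2)) (P.prior.map Subtype.val) :=
    (integrable_map_measure (by fun_prop) measurable_subtype_coe.aemeasurable).2 hint
  have : ProbabilityTheory.integrableExpSet Subtype.val P.prior = Set.univ :=
    Set.eq_univ_of_forall fun t =>
      (SymmetricLaw.integrable_exp_mul hr hint' t).comp_measurable measurable_subtype_coe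
  simp [this]

theorem SubGaussian.integrable_coe (hs : P.SubGaussian) :
    Integrable (fun h : I => (h : ℝ)) P.prior := by
  have h := hs.integrable_rpow_abs zero_le_one
  simp only [Real.rpow_one] at h
  exact (integrable_norm_iff measurable_subtype_coe.aestronglyMeasurable).1 h

variable (P)

theorem measurable_posteriorMean : Measurable P.posteriorMean := by
  have := P.prior_prob
  have h1 : StronglyMeasurable fun a => ∫ h, P.likelihood a h ∂P.prior :=
    StronglyMeasurable.integral_prod_right' P.continuous_likelihood.stronglyMeasurable
  have h2 : StronglyMeasurable fun a => ∫ h : I, P.likelihood a h • (h : ℝ) ∂P.prior :=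
    StronglyMeasurable.integral_prod_right'
      (f := fun x : ((m : Fin M) → J m) × I => P.likelihood x.1 x.2 • (x.2 : ℝ))
      (P.continuous_likelihood.smul (by fun_prop)).stronglyMeasurable
  exact h1.measurable.inv.smul h2.measurable

variable {P}

/-- A mean lies between two values of the variable, here two points of `I`. -/
theorem SubGaussian.posteriorMean_mem (hs : P.SubGaussian) {K : Set ℝ} (hK : K.OrdConnected)
    (hIK : I ⊆ K) (a : (m : Fin M) → J m) : P.posteriorMean a ∈ K := by
  have hi := P.integrable_posterior a hs.integrable_coe
  rw [posteriorMean, postExp_eq_integral]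
  obtain ⟨x, hx⟩ := exists_le_integral hi
  obtain ⟨y, hy⟩ := exists_integral_le hi
  exact hK.out (hIK x.2) (hIK y.2) ⟨hx, hy⟩

/-! ### Bayes risk, conditioned on the features or on the object. -/

variable (P)

/-- The Bayes risk is the mean of the posterior expected costs. -/
theorem bayesRisk_eq_lintegral_postLaw {W : ℝ → ℝ} (hW : Continuous W)
    {g : ((m : Fin M) → J m) → ℝ} (hg : Measurable g) :
    P.bayesRisk (fun c h => W (c - h)) g =
      ∫⁻ a, ENNReal.ofReal (P.evidence a) *
        ∫⁻ x, ENNReal.ofReal (W (g a - x)) ∂P.postLaw a ∂Measure.pi P.ref := by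
  have := P.prior_prob
  have := P.ref_sigmaFinite
  have hlik : Measurable fun x : I × ((m : Fin M) → J m) =>
      ENNReal.ofReal (P.likelihood x.2 x.1) :=
    (P.continuous_likelihood.comp continuous_swap).measurable.ennreal_ofReal
  have hcost : Measurable fun x : I × ((m : Fin M) → J m) =>
      ENNReal.ofReal (W (g x.2 - x.1)) :=
    (hW.measurable.comp ((hg.comp measurable_snd).sub
      (measurable_subtype_coe.comp measurable_fst))).ennreal_ofReal
  rw [bayesRisk, jointLaw, lintegral_withDensity_eq_lintegral_mul _ hlik hcost,
    lintegral_prod_symm _ (hlik.mul hcost).aemeasurable]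
  refine lintegral_congr fun a => ?_
  have hWa : Measurable fun x => ENNReal.ofReal (W (g a - x)) := by
    have : Continuous fun x => W (g a - x) := by fun_prop
    exact this.measurable.ennreal_ofReal
  rw [postLaw, lintegral_map hWa measurable_subtype_coe]
  exact (P.lintegral_posterior a (hWa.comp measurable_subtype_coe)).symm

theorem lintegral_likelihood (h : I) :
    ∫⁻ a, ENNReal.ofReal (P.likelihood a h) ∂Measure.pi P.ref = 1 := by
  have := P.ref_sigmaFinite
  have hnn : ∀ m, 0 ≤ᵐ[P.ref m] fun a => P.dens m a h := fun m =>
    Filter.Eventually.of_forall fun a => (P.dens_pos m a h).le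
  have hmeas : ∀ m, AEStronglyMeasurable (fun a => P.dens m a h) (P.ref m) := fun m =>
    ((P.dens_continuous m).comp (f := fun a : J m => (a, h)) (by fun_prop)).aestronglyMeasurable
  have hi : ∀ m, Integrable (fun a => P.dens m a h) (P.ref m) := fun m =>
    ⟨hmeas m, by
      rw [hasFiniteIntegral_iff_ofReal (hnn m), P.dens_normalized m h]
      exact ENNReal.one_lt_top⟩
  unfold likelihood
  rw [← ofReal_integral_eq_lintegral_ofReal (Integrable.fintype_prod_dep hi)
    (Filter.Eventually.of_forall fun a => Finset.prod_nonneg fun m _ => (P.dens_pos m _ h).le),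
    integral_fintype_prod_eq_prod (fun m a => P.dens m a h)]
  have h1 : ∀ m, ∫ a, P.dens m a h ∂P.ref m = 1 := fun m => by
    rw [integral_eq_lintegral_of_nonneg_ae (hnn m) (hmeas m), P.dens_normalized m h,
      ENNReal.toReal_one]
  simp [h1]

/-- A constant rule ignores the features, so they integrate out; this supplies a rule of finite
risk. -/
theorem bayesRisk_const {W : ℝ → ℝ} (hW : Continuous W) (c : ℝ) :
    P.bayesRisk (fun c h => W (c - h)) (fun _ => c) =
      ∫⁻ h : I, ENNReal.ofReal (W (c - h)) ∂P.prior := by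
  have := P.prior_prob
  have := P.ref_sigmaFinite
  have hlik : Measurable fun x : I × ((m : Fin M) → J m) =>
      ENNReal.ofReal (P.likelihood x.2 x.1) :=
    (P.continuous_likelihood.comp continuous_swap).measurable.ennreal_ofReal
  have hcost : Measurable fun x : I × ((m : Fin M) → J m) =>
      ENNReal.ofReal (W (c - x.1)) := by
    have : Continuous fun x : I × ((m : Fin M) → J m) => W (c - x.1) := by fun_prop
    exact this.measurable.ennreal_ofReal
  rw [bayesRisk, jointLaw, lintegral_withDensity_eq_lintegral_mul _ hlik hcost,
    lintegral_prod _ (hlik.mul hcost).aemeasurable]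
  refine lintegral_congr fun h => ?_
  simp only [Pi.mul_apply]
  have hlik_h : Measurable fun a => ENNReal.ofReal (P.likelihood a h) :=
    hlik.comp measurable_prodMk_left
  rw [lintegral_mul_const _ hlik_h, P.lintegral_likelihood h, one_mul]

end FusionProblem

theorem mainTheorem4 {M : ℕ} {N : Fin M → ℕ} {I : Set ℝ}
    {J : (m : Fin M) → Set (EuclideanSpace ℝ (Fin (N m)))}
    (P : FusionProblem M N I J)
    (hsub : P.SubGaussian) (hzeros : P.SymmetricZeros)
    (K : Set ℝ) (hK : K.OrdConnected) (hIK : I ⊆ K)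
    (W : ℝ → ℝ) (hentire : IsEntireOnReal W) (heven : ∀ x, W (-x) = W x)
    (hnonneg : ∀ x, 0 ≤ W x) (hconvex : ConvexOn ℝ Set.univ W)
    (hgrowth : ∃ α₁ α₂ p : ℝ, 0 < α₁ ∧ 0 < α₂ ∧ 1 ≤ p ∧
      ∀ x : ℝ, α₁ * (|x| ^ p - 1) ≤ |W x| ∧ |W x| ≤ α₂ * (|x| ^ p + 1)) :
    P.IsBayesOptimal K (fun c h => W (c - h)) P.posteriorMean := by
  have hW : Continuous W := by
    simpa [continuousOn_univ] using hconvex.continuousOn isOpen_univ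
  have hmin : ∀ g : ((m : Fin M) → J m) → ℝ, Measurable g →
      P.bayesRisk (fun c h => W (c - h)) P.posteriorMean ≤
        P.bayesRisk (fun c h => W (c - h)) g := by
    intro g hg
    rw [P.bayesRisk_eq_lintegral_postLaw hW P.measurable_posteriorMean,
      P.bayesRisk_eq_lintegral_postLaw hW hg]
    refine lintegral_mono fun a => mul_le_mul_right ?_ _
    exact SymmetricLaw.lintegral_cost_le (hzeros.map_reflection_postLaw hsub a) heven hnonneg
      hconvex (g a)
  refine ⟨⟨P.measurable_posteriorMean, hsub.posteriorMean_mem hK hIK⟩, ?_, fun g hg => hmin g hg.1⟩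
  -- `hmin` covers all measurable rules, so `0` need not belong to `K`.
  refine (hmin (fun _ => 0) measurable_const).trans_lt ?_
  rw [P.bayesRisk_const hW]
  obtain ⟨α₁, α₂, p, -, -, hp, hb⟩ := hgrowth
  have := P.prior_prob
  have hdom : Integrable (fun h : I => α₂ * (|(h : ℝ)| ^ p + 1)) P.prior :=
    ((hsub.integrable_rpow_abs (by linarith)).add (integrable_const 1)).const_mul α₂
  have hint : Integrable (fun h : I => W (0 - h)) P.prior := by
    refine hdom.mono' ?_ (Filter.Eventually.of_forall fun h => ?_)
    · have : Continuous fun h : I => W (0 - h) := by fun_prop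
      exact this.aestronglyMeasurable
    · rw [zero_sub, heven]
      exact (hb h).2
  exact hint.lintegral_lt_top
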